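/- Let $\{T_n:n\ge 1\}$ be i.i.d. positive random variables on a probability space $(\Omega,\mathcal F,P)$, and for $\alpha\in\mathbb R$ let $\varphi(\alpha)=\log\mathbb E[e^{\alpha T_1}]\in(-\infty,\infty]$ and $\mathcal D(\varphi)=\{\alpha\in\mathbb R:\varphi(\alpha)<\infty\}$. Assume that $0$ belongs to the interior of $\mathcal D(\varphi)$. For $t\ge 0$ and $x>0$ let $$N(t)=\sum_{n\ge 1}1_{\{T_1+\cdots+T_n\le t\}},\qquad \tau(x)=\inf\{t\ge 0:x-N(t)\le 0\},\qquad A(x)=\int_0^{\tau(x)}(x-N(t))\,dt .$$ Put $\bar\alpha=\sup\mathcal D(\varphi)\in(0,\infty]$ and $$\mathcal D=\{(\alpha_1,\alpha_2)\in\mathbb R^2:\alpha_2\ge 0,\ \alpha_1+\alpha_2\in\mathcal D(\varphi)\}\cup\{(\alpha_1,\alpha_2)\in\mathbb R^2:\alpha_2<0,\ \alpha_1\le\bar\alpha\}$$ (so $\mathcal D=\mathbb R^2$ if $\mathcal D(\varphi)=\mathbb R$), and define $$\Lambda(\alpha_1,\alpha_2)=\int_0^1\varphi(\alpha_1+\alpha_2y)\,dy\in(-\infty,\infty]\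 \text{ if }(\alpha_1,\alpha_2)\in\mathcal D,\qquad \Lambda(\alpha_1,\alpha_2)=\infty\ \text{ otherwise,}$$ $$\Lambda^*(z_1,z_2)=\sup_{(\alpha_1,\alpha_2)\in\mathbb R^2}\{\alpha_1z_1+\alpha_2z_2-\Lambda(\alpha_1,\alpha_2)\}.$$ Let $\mathcal E$ be the set of exposed points of $\Lambda^*$, i.e. of the $z\in\mathbb R^2$ for which there is $\alpha\in\mathbb R^2$ with $\langle\alpha,z\rangle-\Lambda^*(z)>\langle\alpha,w\rangle-\Lambda^*(w)$ for all $w\in\mathbb R^2$, $w\ne z$. Then $\Lambda$ is finite in a neighborhood of $(0,0)$, and, as $x\to\infty$ through the real numbers (with $\log 0=-\infty$ and $\inf\emptyset=\infty$), $$\limsup_{x\to\infty}\frac1x\log P\left(\left(\frac{\tau(x)}{x},\frac{A(x)}{x^2}\right)\in C\right)\le-\inf_{z\in C}\Lambda^*(z)\quad\text{for all closed sets }C\subseteq\mathbb R^2,$$ $$\liminf_{x\to\infty}\frac1x\log P\left(\left(\frac{\tau(x)}{x},\frac{A(x)}{x^2}\right)\in O\right)\ge-\inf_{z\in O\cap\mathcal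 E}\Lambda^*(z)\quad\text{for all open sets }O\subseteq\mathbb R^2.$$ -/

import Mathlib

open MeasureTheory ProbabilityTheory Filter Topology
open scoped ENNReal

noncomputable section

namespace FirstPassage

/-! ### The renewal process, its first-passage time and its first-passage area

A sequence of holding times is `T : ℕ → ℝ`; the entry `T n` is the `(n + 1)`-st holding time. -/

/-- `N(t) = ∑_{n ≥ 1} 1_{T₁ + ⋯ + Tₙ ≤ t}`, with values in `[0, ∞]`. -/
def renewal (T : ℕ → ℝ) (t : ℝ) : ℝ≥0∞ :=
  ∑' n : ℕ, if ∑ i ∈ Finset.range (n + 1), T i ≤ t then 1 else 0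

/-- The process `X(t) = x - N(t)` started at the level `x`. -/
def level (T : ℕ → ℝ) (x t : ℝ) : EReal := (x : EReal) - (renewal T t : EReal)

/-- `τ(x) = inf {t ≥ 0 : X(t) ≤ 0}`. -/
def tau (T : ℕ → ℝ) (x : ℝ) : ℝ := sInf {t : ℝ | 0 ≤ t ∧ level T x t ≤ 0}

/-- `A(x) = ∫₀^τ(x) X(t) dt`; before `τ(x)` the integrand is a real number in `(0, x]`. -/
def area (T : ℕ → ℝ) (x : ℝ) : ℝ := ∫ t in (0 : ℝ)..tau T x, (level T x t).toReal

/-! ### The functions `φ`, `Λ` and `Λ*` -/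

/-- `log E[e^{αY}]` as an extended real number. -/
def logMgf {Ω : Type*} [MeasurableSpace Ω] (P : Measure Ω) (Y : Ω → ℝ) (α : ℝ) : EReal :=
  ENNReal.log (∫⁻ ω, ENNReal.ofReal (Real.exp (α * Y ω)) ∂P)

/-- The integral over `[0, 1]` of an extended-real-valued function, as the integral of its
positive part minus the integral of its negative part. -/
def unitIntegral (f : ℝ → EReal) : EReal :=
  ((∫⁻ y in Set.Icc (0 : ℝ) 1, (f y).toENNReal : ℝ≥0∞) : EReal)
    - ((∫⁻ y in Set.Icc (0 : ℝ) 1, (-f y).toENNReal : ℝ≥0∞) : EReal)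

/-- The effective domain `{u : f(u) < ∞}`. -/
def effDomain {E : Type*} (f : E → EReal) : Set E := {u | f u < ⊤}

/-- The right end point `ᾱ ∈ (-∞, ∞]` of the effective domain of `φ`. -/
def rightEnd (φ : ℝ → EReal) : EReal := ⨆ α ∈ effDomain φ, (α : EReal)

/-- The set `𝒟` of the pairs with `α₂ ≥ 0` and `φ(α₁ + α₂) < ∞`, or with `α₂ < 0` and `α₁ ≤ ᾱ`.
If `φ` is finite everywhere then `ᾱ = ∞` and this is the whole plane. -/
def domainD (φ : ℝ → EReal) : Set (ℝ × ℝ) :=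
  {α | 0 ≤ α.2 ∧ α.1 + α.2 ∈ effDomain φ} ∪ {α | α.2 < 0 ∧ (α.1 : EReal) ≤ rightEnd φ}

open Classical in
/-- `Λ(α₁, α₂) = ∫₀¹ φ(α₁ + α₂ y) dy` on `𝒟`, and `Λ = ∞` off `𝒟`. -/
def Lam (φ : ℝ → EReal) (α : ℝ × ℝ) : EReal :=
  if α ∈ domainD φ then unitIntegral (fun y => φ (α.1 + α.2 * y)) else ⊤

/-- The Legendre transform `f*(z) = sup_α {α₁ z₁ + α₂ z₂ - f(α)}` on the plane. -/
def legendre (f : ℝ × ℝ → EReal) (z : ℝ × ℝ) : EReal :=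
  ⨆ α : ℝ × ℝ, ((α.1 * z.1 + α.2 * z.2 : ℝ) : EReal) - f α

/-- The exposed points of `g`: those `z` for which there is an exposing `α` with
`⟨α, z⟩ - g(z) > ⟨α, w⟩ - g(w)` for all `w ≠ z`. -/
def exposedPts (g : ℝ × ℝ → EReal) : Set (ℝ × ℝ) :=
  {z | ∃ α : ℝ × ℝ, ∀ w : ℝ × ℝ, w ≠ z →
    ((α.1 * w.1 + α.2 * w.2 : ℝ) : EReal) - g w < ((α.1 * z.1 + α.2 * z.2 : ℝ) : EReal) - g z}

/-! ### The scaled pair and the exponential rate of its probabilities -/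

/-- The pair `(τ(x)/x, A(x)/x²)`. -/
def scaledPair (T : ℕ → ℝ) (x : ℝ) : ℝ × ℝ := (tau T x / x, area T x / x ^ 2)

/-- `(1/x) log P((τ(x)/x, A(x)/x²) ∈ B)` as an extended real number. -/
def logProbRate {Ω : Type*} [MeasurableSpace Ω] (P : Measure Ω) (T : ℕ → Ω → ℝ)
    (B : Set (ℝ × ℝ)) (x : ℝ) : EReal :=
  ((1 / x : ℝ) : EReal) * ENNReal.log (P {ω | scaledPair (fun n => T n ω) x ∈ B})

end FirstPassage

end

/-! The level equals `x - k` while the holding time `T k` runs, so for positive `T` the scaled pair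
is a linear function of the first `⌈x⌉` holding times (`scaledPair_eq_weightedPair`). Paired with `x
• α`, it becomes a sum of independent terms `(α₁ + α₂ (1 - k/x)) T k`. Its log-moment generating
function, divided by `x`, is a Riemann sum of `φ` that converges to `Λ(α)` whenever `φ` is finite
near the whole segment from `α₁` to `α₁ + α₂`, that is, on `innerDomain`. Gärtner–Ellis then
applies, provided that the boundary of `𝒟` can be avoided.

Two facts do this. Since `T > 0`, `φ` is nondecreasing. Lowering `α₁` by a small `ε` moves any point
of `𝒟` into `innerDomain`, does not increase `Λ`, and hardly changes the linear term, so the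
supremum defining `Λ*` may be taken over `innerDomain` (`exists_lt_of_lt_legendre`). And an exposing
`η` is automatically in `innerDomain` (`mem_innerDomain_of_exposes`): otherwise some direction `v`
has `⟨β, v⟩ ≤ ⟨η, v⟩` on `𝒟`, and moving along `v` would not decrease `⟨η, ·⟩ - Λ*`. Hence neither
convergence on the boundary nor steepness is needed. -/

noncomputable section

namespace FirstPassage

section Measures

/-! ### Exponential bounds for families of measures on the plane -/

/-- The scaled moment generating function `∫ exp(x ⟨α, w⟩) dμ(w)`. -/
def scaledMgf (μ : Measure (ℝ × ℝ)) (x : ℝ) (α : ℝ × ℝ) : ℝ≥0∞ :=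
  ∫⁻ w, ENNReal.ofReal (Real.exp (x * (α.1 * w.1 + α.2 * w.2))) ∂μ

/-- `S` has exponential rate strictly better than `c` under the family `μ`. -/
def DecaysFaster (μ : ℝ → Measure (ℝ × ℝ)) (c : ℝ) (S : Set (ℝ × ℝ)) : Prop :=
  ∃ c' > c, ∀ᶠ x in atTop, μ x S ≤ ENNReal.ofReal (Real.exp (-c' * x))

lemma eventually_const_mul_exp_le (K : ℝ) {a b : ℝ} (h : a < b) :
    ∀ᶠ x : ℝ in atTop, K * Real.exp (a * x) ≤ Real.exp (b * x) := by
  have h1 : Tendsto (fun x : ℝ => Real.exp ((b - a) * x)) atTop atTop :=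
    Real.tendsto_exp_atTop.comp (tendsto_id.const_mul_atTop (sub_pos.2 h))
  filter_upwards [h1.eventually_ge_atTop K] with x hx
  calc K * Real.exp (a * x) ≤ Real.exp ((b - a) * x) * Real.exp (a * x) := by gcongr
    _ = Real.exp (b * x) := by rw [← Real.exp_add]; ring_nf

variable {μ : ℝ → Measure (ℝ × ℝ)} {c : ℝ}

lemma DecaysFaster.mono {S S' : Set (ℝ × ℝ)} (h : DecaysFaster μ c S') (hS : S ⊆ S') :
    DecaysFaster μ c S := by
  obtain ⟨c', hc', h⟩ := h
  exact ⟨c', hc', h.mono fun x hx => (measure_mono hS).trans hx⟩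

lemma decaysFaster_empty : DecaysFaster μ c ∅ :=
  ⟨c + 1, by simp, Eventually.of_forall fun x => by simp⟩

/-- The strict inequality `c' > c` leaves room for the factor 2 of the union bound, so finite covers
are allowed. -/
lemma DecaysFaster.union {S S' : Set (ℝ × ℝ)} (h : DecaysFaster μ c S)
    (h' : DecaysFaster μ c S') : DecaysFaster μ c (S ∪ S') := by
  obtain ⟨a, ha, h⟩ := h
  obtain ⟨b, hb, h'⟩ := h'
  obtain ⟨d, hd, hd'⟩ := exists_between (lt_min ha hb)
  refine ⟨d, hd, ?_⟩
  have hda : -min a b < -d := neg_lt_neg hd'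
  filter_upwards [h, h', eventually_const_mul_exp_le 2 hda, eventually_ge_atTop 0]
    with x hx hx' hx2 hx0
  have ea : Real.exp (-a * x) ≤ Real.exp (-min a b * x) := by
    gcongr; exact min_le_left _ _
  have eb : Real.exp (-b * x) ≤ Real.exp (-min a b * x) := by
    gcongr; exact min_le_right _ _
  calc μ x (S ∪ S') ≤ μ x S + μ x S' := measure_union_le _ _
    _ ≤ ENNReal.ofReal (Real.exp (-a * x)) + ENNReal.ofReal (Real.exp (-b * x)) := by gcongr
    _ = ENNReal.ofReal (Real.exp (-a * x) + Real.exp (-b * x)) :=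
        (ENNReal.ofReal_add (by positivity) (by positivity)).symm
    _ ≤ _ := ENNReal.ofReal_le_ofReal (by linarith)

/-- Chernoff's bound. Half of the gap `d - (c + l)` pays for the error `ε`; the other half is the
strict gain in the rate. -/
lemma decaysFaster_halfSpace {α : ℝ × ℝ} {l d : ℝ}
    (hα : ∀ ε > 0, ∀ᶠ x in atTop,
      scaledMgf (μ x) x α ≤ ENNReal.ofReal (Real.exp (x * (l + ε)))) (hd : c + l < d) :
    DecaysFaster μ c {w | d < α.1 * w.1 + α.2 * w.2} := by
  obtain ⟨ε, hε, hεd⟩ : ∃ ε > 0, c + l + 2 * ε = d := ⟨(d - (c + l)) / 2, by linarith, by ring⟩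
  refine ⟨c + ε, by linarith, ?_⟩
  filter_upwards [hα ε hε, eventually_ge_atTop 0] with x hx hx0
  set g : ℝ × ℝ → ℝ≥0∞ :=
    fun w => ENNReal.ofReal (Real.exp (x * (α.1 * w.1 + α.2 * w.2))) with hg
  have hsub : {w : ℝ × ℝ | d < α.1 * w.1 + α.2 * w.2} ⊆
      {w | ENNReal.ofReal (Real.exp (x * d)) ≤ g w} := by
    intro w hw
    have hw' : d < α.1 * w.1 + α.2 * w.2 := hw
    simp only [hg, Set.mem_ofPred_eq]
    gcongr
  have hgm : Measurable g := by simp only [hg]; fun_prop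
  have h1 := (mul_meas_ge_le_lintegral hgm (μ := μ x) (ENNReal.ofReal (Real.exp (x * d)))).trans hx
  calc μ x {w | d < α.1 * w.1 + α.2 * w.2}
      ≤ μ x {w | ENNReal.ofReal (Real.exp (x * d)) ≤ g w} := measure_mono hsub
    _ = ENNReal.ofReal (Real.exp (-(x * d))) * (ENNReal.ofReal (Real.exp (x * d)) *
          μ x {w | ENNReal.ofReal (Real.exp (x * d)) ≤ g w}) := by
        rw [← mul_assoc, ← ENNReal.ofReal_mul (by positivity), ← Real.exp_add]; simp
    _ ≤ ENNReal.ofReal (Real.exp (-(x * d))) * ENNReal.ofReal (Real.exp (x * (l + ε))) := by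
        gcongr
    _ = ENNReal.ofReal (Real.exp (-(c + ε) * x)) := by
        rw [← ENNReal.ofReal_mul (by positivity), ← Real.exp_add, ← hεd]; ring_nf

variable {G : Set (ℝ × ℝ)} {L : ℝ × ℝ → ℝ}

/-- The Gärtner–Ellis upper bound. -/
theorem decaysFaster_of_isClosed (hG : (0 : ℝ × ℝ) ∈ interior G)
    (hL : ∀ α ∈ G, ∀ ε > 0, ∀ᶠ x in atTop,
      scaledMgf (μ x) x α ≤ ENNReal.ofReal (Real.exp (x * (L α + ε))))
    {C : Set (ℝ × ℝ)} (hC : IsClosed C)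
    (hc : ∀ w ∈ C, ∃ α ∈ G, c + L α < α.1 * w.1 + α.2 * w.2) :
    DecaysFaster μ c C := by
  obtain ⟨r, hr, hrG⟩ : ∃ r > 0, ∀ s t : ℝ, |s| ≤ r → |t| ≤ r → (s, t) ∈ G := by
    obtain ⟨r, hr, h⟩ := Metric.mem_nhds_iff.1 (mem_interior_iff_mem_nhds.1 hG)
    refine ⟨r / 2, by linarith, fun s t hs ht => h ?_⟩
    simp only [Metric.mem_ball, dist_zero_right, Prod.norm_def, sup_lt_iff, Real.norm_eq_abs]
    constructor <;> linarith
  have hr' : |r| ≤ r := (abs_of_pos hr).le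
  have hr'' : |-r| ≤ r := by rwa [abs_neg]
  have h0 : |(0 : ℝ)| ≤ r := by simpa using hr.le
  -- Exponential tightness: four half-spaces, with normals along the axes inside `G`, cover the
  -- complement of a rectangle. Any threshold above `c + L` would do.
  have g1 := decaysFaster_halfSpace (c := c) (hL _ (hrG r 0 hr' h0)) (lt_add_one _)
  have g2 := decaysFaster_halfSpace (c := c) (hL _ (hrG (-r) 0 hr'' h0)) (lt_add_one _)
  have g3 := decaysFaster_halfSpace (c := c) (hL _ (hrG 0 r h0 hr')) (lt_add_one _)
  have g4 := decaysFaster_halfSpace (c := c) (hL _ (hrG 0 (-r) h0 hr'')) (lt_add_one _)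
  set d1 := c + L (r, 0) + 1
  set d2 := c + L (-r, 0) + 1
  set d3 := c + L (0, r) + 1
  set d4 := c + L (0, -r) + 1
  have hK : IsCompact (Set.Icc (-(d2 / r)) (d1 / r) ×ˢ Set.Icc (-(d4 / r)) (d3 / r)) :=
    isCompact_Icc.prod isCompact_Icc
  have gK : DecaysFaster μ c
      (C ∩ (Set.Icc (-(d2 / r)) (d1 / r) ×ˢ Set.Icc (-(d4 / r)) (d3 / r))) := by
    -- On the compact part, each point has a neighbourhood inside a good half-space, and finitely
    -- many of these suffice.
    refine (hK.inter_left hC).induction_on decaysFaster_empty (fun s t hst ht => ht.mono hst)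
      (fun s t hs ht => hs.union ht) fun w hw => ?_
    obtain ⟨α, hα, hlt⟩ := hc w hw.1
    obtain ⟨d, hd, hd'⟩ := exists_between hlt
    refine ⟨_, mem_nhdsWithin_of_mem_nhds ?_, decaysFaster_halfSpace (hL α hα) hd⟩
    exact (isOpen_lt (by fun_prop) (by fun_prop)).mem_nhds hd'
  refine (((gK.union g1).union (g2.union g3)).union g4).mono fun w hw => ?_
  by_contra hcon
  simp only [Set.mem_union, Set.mem_inter_iff, hw, true_and, Set.mem_prod, Set.mem_Icc,
    Set.mem_ofPred_eq, not_or, not_lt] at hcon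
  obtain ⟨⟨⟨h, h1⟩, h2, h3⟩, h4⟩ := hcon
  refine h ⟨⟨?_, ?_⟩, ?_, ?_⟩
  · rw [neg_le, le_div_iff₀ hr]; linarith
  · rw [le_div_iff₀ hr]; linarith
  · rw [neg_le, le_div_iff₀ hr]; linarith
  · rw [le_div_iff₀ hr]; linarith

/-- The Gärtner–Ellis lower bound at a point exposed by an interior hyperplane. -/
theorem eventually_exp_le_measure (hGo : IsOpen G)
    (hL : ∀ α ∈ G, ∀ ε > 0, ∀ᶠ x in atTop,
      scaledMgf (μ x) x α ≤ ENNReal.ofReal (Real.exp (x * (L α + ε))))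
    {η : ℝ × ℝ} (hη : η ∈ G)
    (hLη : ∀ ε > 0, ∀ᶠ x in atTop,
      ENNReal.ofReal (Real.exp (x * (L η - ε))) ≤ scaledMgf (μ x) x η)
    {z : ℝ × ℝ} (hz : ∀ w, w ≠ z → ∃ α ∈ G,
      η.1 * w.1 + η.2 * w.2 - L η < α.1 * w.1 + α.2 * w.2 - L α)
    {O : Set (ℝ × ℝ)} (hO : IsOpen O) (hzO : z ∈ O) {a : ℝ}
    (ha : a < L η - (η.1 * z.1 + η.2 * z.2)) :
    ∀ᶠ x in atTop, ENNReal.ofReal (Real.exp (a * x)) ≤ μ x O := by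
  -- One `κ` is spent on the width of the slab `U`, two on the mass that `U` keeps after tilting.
  obtain ⟨κ, hκ, hκa⟩ : ∃ κ > 0, a + 3 * κ = L η - (η.1 * z.1 + η.2 * z.2) :=
    ⟨(L η - (η.1 * z.1 + η.2 * z.2) - a) / 3, by linarith, by ring⟩
  set U : Set (ℝ × ℝ) := O ∩ {w | η.1 * w.1 + η.2 * w.2 < η.1 * z.1 + η.2 * z.2 + κ} with hU
  have hUo : IsOpen U := hO.inter (isOpen_lt (by fun_prop) (by fun_prop))
  have hzU : z ∈ U := ⟨hzO, by simp [hκ]⟩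
  set g : ℝ → ℝ × ℝ → ℝ≥0∞ :=
    fun x w => ENNReal.ofReal (Real.exp (x * (η.1 * w.1 + η.2 * w.2))) with hg
  have hgm : ∀ x, Measurable (g x) := fun x => by simp only [hg]; fun_prop
  set ν : ℝ → Measure (ℝ × ℝ) := fun x => (μ x).withDensity (g x) with hν
  have hmgf : ∀ x β, scaledMgf (ν x) x β = scaledMgf (μ x) x (β + η) := by
    intro x β
    simp only [scaledMgf, hν]
    rw [lintegral_withDensity_eq_lintegral_mul _ (hgm x) (by fun_prop)]
    refine lintegral_congr fun w => ?_
    simp only [hg, Pi.mul_apply, Prod.fst_add, Prod.snd_add]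
    rw [← ENNReal.ofReal_mul (by positivity), ← Real.exp_add]
    ring_nf
  have hG' : (0 : ℝ × ℝ) ∈ interior {β | β + η ∈ G} := by
    have hopen : IsOpen {β | β + η ∈ G} := hGo.preimage (by fun_prop)
    rw [hopen.interior_eq]
    simpa using hη
  -- The upper bound for the unnormalized tilted measures shows that the mass off `U` is
  -- exponentially smaller than the total mass, which is about `exp (x * L η)`.
  obtain ⟨c', hc', hdec⟩ := decaysFaster_of_isClosed (μ := ν) (c := -L η)
    (G := {β | β + η ∈ G}) (L := fun β => L (β + η)) hG'
    (fun α hα ε hε => by simpa only [hmgf] using hL _ hα ε hε) hUo.isClosed_compl (by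
      intro w hw
      obtain ⟨α, hα, h⟩ := hz w (fun h => hw (h ▸ hzU))
      refine ⟨α - η, by simpa using hα, ?_⟩
      simp only [sub_add_cancel, Prod.fst_sub, Prod.snd_sub]
      linarith)
  set κ' := min κ ((c' + L η) / 2) with hκ'
  have hκ'0 : 0 < κ' := lt_min hκ (by linarith)
  have hκ'1 : κ' ≤ κ := min_le_left _ _
  have hκ'2 : κ' ≤ (c' + L η) / 2 := min_le_right _ _
  have hb : L η - 2 * κ < L η - κ' := by linarith
  have hb' : -c' < L η - κ' := by linarith
  filter_upwards [hdec, hLη κ' hκ'0, eventually_const_mul_exp_le 2 hb,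
    eventually_const_mul_exp_le 2 hb', eventually_ge_atTop 0] with x h1 h2 h3 h4 hx0
  have htot : ENNReal.ofReal (Real.exp (x * (L η - κ'))) ≤ ν x U + ν x Uᶜ := by
    rw [measure_add_measure_compl hUo.measurableSet]
    refine h2.trans (le_of_eq ?_)
    simp [hν, scaledMgf, hg]
  -- If this failed, `U` and its complement would each carry less than half of the total mass.
  have hball : ENNReal.ofReal (Real.exp ((L η - 2 * κ) * x)) ≤ ν x U := by
    by_contra! hlt
    have hsum : ν x U + ν x Uᶜ < ENNReal.ofReal (Real.exp ((L η - 2 * κ) * x)) +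
        ENNReal.ofReal (Real.exp (-c' * x)) :=
      ENNReal.add_lt_add_of_lt_of_le (ne_top_of_le_ne_top ENNReal.ofReal_ne_top h1) hlt h1
    rw [← ENNReal.ofReal_add (by positivity) (by positivity)] at hsum
    have := htot.trans_lt hsum
    rw [ENNReal.ofReal_lt_ofReal_iff (by positivity), mul_comm x] at this
    linarith
  have hνU : ν x U ≤ ENNReal.ofReal (Real.exp (x * (η.1 * z.1 + η.2 * z.2 + κ))) * μ x U := by
    simp only [hν]
    rw [withDensity_apply _ hUo.measurableSet, ← setLIntegral_const]
    refine setLIntegral_mono measurable_const fun w hw => ?_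
    have : η.1 * w.1 + η.2 * w.2 < η.1 * z.1 + η.2 * z.2 + κ := hw.2
    simp only [hg]
    gcongr
  calc ENNReal.ofReal (Real.exp (a * x))
      = ENNReal.ofReal (Real.exp (-(x * (η.1 * z.1 + η.2 * z.2 + κ)))) *
          ENNReal.ofReal (Real.exp ((L η - 2 * κ) * x)) := by
        rw [← ENNReal.ofReal_mul (by positivity), ← Real.exp_add]
        congr 2
        linear_combination x * hκa
    _ ≤ ENNReal.ofReal (Real.exp (-(x * (η.1 * z.1 + η.2 * z.2 + κ)))) *
          (ENNReal.ofReal (Real.exp (x * (η.1 * z.1 + η.2 * z.2 + κ))) * μ x U) := by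
        gcongr; exact hball.trans hνU
    _ = μ x U := by
        rw [← mul_assoc, ← ENNReal.ofReal_mul (by positivity), ← Real.exp_add]; simp
    _ ≤ μ x O := measure_mono Set.inter_subset_left

end Measures

/-! ### The path formulas for the passage time and the area -/

/-- The sums `∑ T k / x` and `∑ (1 - k / x) T k / x` over `k < ⌈x⌉`. -/
def weightedPair (T : ℕ → ℝ) (x : ℝ) : ℝ × ℝ :=
  (1 / x * ∑ k ∈ Finset.range ⌈x⌉₊, T k, 1 / x * ∑ k ∈ Finset.range ⌈x⌉₊, (1 - k / x) * T k)

section Path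

variable {T : ℕ → ℝ} (hT : ∀ n, 0 < T n)
include hT

lemma monotone_partialSum : Monotone fun n => ∑ i ∈ Finset.range n, T i :=
  monotone_nat_of_le_succ fun n => by
    rw [Finset.sum_range_succ]; linarith [hT n]

lemma partialSum_succ_pos (n : ℕ) : 0 < ∑ i ∈ Finset.range (n + 1), T i :=
  Finset.sum_pos (fun i _ => hT i) (by simp)

lemma le_renewal {n : ℕ} {t : ℝ} (h : ∑ i ∈ Finset.range n, T i ≤ t) :
    (n : ℝ≥0∞) ≤ renewal T t := by
  refine le_trans (le_of_eq ?_) (ENNReal.sum_le_tsum (Finset.range n))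
  rw [Finset.sum_congr rfl fun k hk => if_pos ((monotone_partialSum hT
    (Nat.succ_le_of_lt (Finset.mem_range.1 hk))).trans h)]
  simp

lemma renewal_of_lt {m : ℕ} {t : ℝ} (h : t < ∑ i ∈ Finset.range (m + 1), T i) :
    renewal T t =
      ∑ k ∈ Finset.range m, if ∑ i ∈ Finset.range (k + 1), T i ≤ t then 1 else 0 := by
  refine tsum_eq_sum fun k hk => if_neg (not_le.2 (h.trans_le ?_))
  exact monotone_partialSum hT (by simpa using hk)

omit hT in
lemma coe_ennreal_natCast (n : ℕ) : ((n : ℝ≥0∞) : EReal) = n := by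
  rfl

lemma level_of_lt {m : ℕ} {t : ℝ} (x : ℝ) (h : t < ∑ i ∈ Finset.range (m + 1), T i) :
    level T x t = ((x - ∑ k ∈ Finset.range m,
      if ∑ i ∈ Finset.range (k + 1), T i ≤ t then 1 else 0 : ℝ) : EReal) := by
  have : (renewal T t : EReal) = ((∑ k ∈ Finset.range m,
      if ∑ i ∈ Finset.range (k + 1), T i ≤ t then 1 else 0 : ℝ) : EReal) := by
    rw [renewal_of_lt hT h, ← Finset.natCast_card_filter, ← Finset.natCast_card_filter]
    simp only [coe_ennreal_natCast, EReal.coe_natCast]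
  rw [level, this, EReal.coe_sub]

/-- As `N(t)` is integer-valued or infinite, `N(t) ≥ x` means `N(t) ≥ ⌈x⌉`: the arrival number `⌈x⌉`
has occurred by time `t`. -/
lemma level_nonpos_iff {x t : ℝ} (hx : 0 < x) :
    level T x t ≤ 0 ↔ ∑ i ∈ Finset.range ⌈x⌉₊, T i ≤ t := by
  refine ⟨fun h => ?_, fun h => ?_⟩
  · by_contra! hlt
    obtain ⟨m, hm⟩ := Nat.exists_eq_succ_of_ne_zero (Nat.ceil_pos.2 hx).ne'
    rw [hm] at hlt
    rw [level_of_lt hT x hlt, ← EReal.coe_zero, EReal.coe_le_coe_iff] at h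
    have hmx : (m : ℝ) < x := Nat.lt_ceil.1 (by omega)
    have hle : (∑ k ∈ Finset.range m,
        if ∑ i ∈ Finset.range (k + 1), T i ≤ t then 1 else 0 : ℝ) ≤ m := by
      rw [← Finset.natCast_card_filter]
      exact_mod_cast (Finset.card_filter_le _ _).trans (by simp)
    linarith
  · have h1 : ((⌈x⌉₊ : ℝ≥0∞) : EReal) ≤ renewal T t :=
      EReal.coe_ennreal_le_coe_ennreal_iff.2 (le_renewal hT h)
    have h2 : (x : EReal) ≤ ((⌈x⌉₊ : ℝ≥0∞) : EReal) := by
      rw [coe_ennreal_natCast]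
      exact_mod_cast Nat.le_ceil x
    exact EReal.sub_nonpos.2 (h2.trans h1)

lemma tau_eq_sum {x : ℝ} (hx : 0 < x) : tau T x = ∑ i ∈ Finset.range ⌈x⌉₊, T i := by
  have : {t : ℝ | 0 ≤ t ∧ level T x t ≤ 0} = Set.Ici (∑ i ∈ Finset.range ⌈x⌉₊, T i) := by
    ext t
    simp only [Set.mem_ofPred_eq, level_nonpos_iff hT hx, Set.mem_Ici, and_iff_right_iff_imp]
    exact (Finset.sum_nonneg fun i _ => (hT i).le).trans
  rw [tau, this, csInf_Ici]

omit hT in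
lemma integral_ite_le {s b : ℝ} (hs : 0 < s) (hsb : s ≤ b) :
    ∫ t in (0 : ℝ)..b, (if s ≤ t then (1 : ℝ) else 0) = b - s := by
  have h : (fun t : ℝ => if s ≤ t then (1 : ℝ) else 0) = (Set.Ici s).indicator 1 := by
    ext t; simp [Set.indicator_apply]
  rw [intervalIntegral.integral_of_le (hs.le.trans hsb), h,
    integral_indicator_one measurableSet_Ici, measureReal_restrict_apply measurableSet_Ici]
  have : Set.Ici s ∩ Set.Ioc 0 b = Set.Icc s b := by
    ext t; simp only [Set.mem_inter_iff, Set.mem_Ici, Set.mem_Ioc, Set.mem_Icc]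
    constructor
    · rintro ⟨h1, -, h2⟩; exact ⟨h1, h2⟩
    · rintro ⟨h1, h2⟩; exact ⟨h1, hs.trans_le h1, h2⟩
  rw [this, Real.volume_real_Icc_of_le hsb]

omit hT in
-- Summation by parts: `T k` occurs in the difference of partial sums of index `j` exactly when `j <
-- k`, hence `k` times.
lemma sub_sum_partialSum (T : ℕ → ℝ) (x : ℝ) (m : ℕ) :
    x * ∑ i ∈ Finset.range (m + 1), T i - ∑ k ∈ Finset.range m,
      (∑ i ∈ Finset.range (m + 1), T i - ∑ i ∈ Finset.range (k + 1), T i) =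
    ∑ k ∈ Finset.range (m + 1), (x - k) * T k := by
  induction m with
  | zero => simp
  | succ m ih =>
    rw [Finset.sum_range_succ (fun k => (x - k) * T k), ← ih]
    simp only [Finset.sum_sub_distrib, Finset.sum_const, Finset.card_range, nsmul_eq_mul]
    rw [Finset.sum_range_succ (fun k => ∑ i ∈ Finset.range (k + 1), T i) m,
      Finset.sum_range_succ T (m + 1)]
    push_cast
    ring

lemma area_eq_sum {x : ℝ} (hx : 0 < x) :
    area T x = ∑ k ∈ Finset.range ⌈x⌉₊, (x - k) * T k := by
  obtain ⟨m, hm⟩ := Nat.exists_eq_succ_of_ne_zero (Nat.ceil_pos.2 hx).ne'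
  rw [area, tau_eq_sum hT hx, hm, Nat.succ_eq_add_one]
  have hint : ∀ k ∈ Finset.range m, IntervalIntegrable (fun t : ℝ =>
      if ∑ i ∈ Finset.range (k + 1), T i ≤ t then (1 : ℝ) else 0) volume 0
      (∑ i ∈ Finset.range (m + 1), T i) := by
    intro k _
    refine Monotone.intervalIntegrable fun a b hab => ?_
    by_cases h : ∑ i ∈ Finset.range (k + 1), T i ≤ a
    · simp [h, h.trans hab]
    · simp only [if_neg h]; split_ifs <;> simp
  calc _ = ∫ t in (0 : ℝ)..∑ i ∈ Finset.range (m + 1), T i, (x - ∑ k ∈ Finset.range m,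
          if ∑ i ∈ Finset.range (k + 1), T i ≤ t then (1 : ℝ) else 0) := by
        -- The finite formula for the level requires `t` strictly before passage; the right endpoint
        -- is a null set.
        have hne : ∀ᵐ t : ℝ, t ≠ ∑ i ∈ Finset.range (m + 1), T i := Measure.ae_ne volume _
        refine intervalIntegral.integral_congr_ae (hne.mono fun t ht htm => ?_)
        rw [Set.uIoc_of_le (partialSum_succ_pos hT m).le] at htm
        rw [level_of_lt hT x (lt_of_le_of_ne htm.2 ht), EReal.toReal_coe]
    _ = x * ∑ i ∈ Finset.range (m + 1), T i - ∑ k ∈ Finset.range m,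
          (∑ i ∈ Finset.range (m + 1), T i - ∑ i ∈ Finset.range (k + 1), T i) := by
        rw [intervalIntegral.integral_sub (by simp)
          (by simpa only [Finset.sum_fn] using IntervalIntegrable.sum _ hint),
          intervalIntegral.integral_finsetSum hint]
        congr 1
        · simp [mul_comm]
        · refine Finset.sum_congr rfl fun k hk => integral_ite_le (partialSum_succ_pos hT k) ?_
          exact monotone_partialSum hT (by have := Finset.mem_range.1 hk; omega)
    _ = _ := sub_sum_partialSum T x m

lemma scaledPair_eq_weightedPair {x : ℝ} (hx : 0 < x) : scaledPair T x = weightedPair T x := by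
  rw [scaledPair, weightedPair, tau_eq_sum hT hx, area_eq_sum hT hx, Finset.mul_sum,
    Finset.sum_div, Finset.mul_sum, Finset.sum_div]
  congr 1
  · exact Finset.sum_congr rfl fun k _ => by ring
  · exact Finset.sum_congr rfl fun k _ => by field_simp

end Path

lemma mul_pairing_weightedPair (T : ℕ → ℝ) {x : ℝ} (hx : x ≠ 0) (a b : ℝ) :
    x * (a * (weightedPair T x).1 + b * (weightedPair T x).2) =
      ∑ k ∈ Finset.range ⌈x⌉₊, (a + b * (1 - k / x)) * T k := by
  simp only [weightedPair, Finset.mul_sum, ← Finset.sum_add_distrib]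
  refine Finset.sum_congr rfl fun k _ => ?_
  field_simp

/-! ### Riemann sums -/

/-- The sum is compared with the integral over `[0, ⌈x⌉/x]`, whose last cell may stick out of `[0,
1]`; at most `2x` cells each contribute an error of at most `ε / (4x)`. -/
lemma tendsto_riemannSum_of_uniformContinuous {h : ℝ → ℝ} (hh : UniformContinuous h) :
    Tendsto (fun x : ℝ => 1 / x * ∑ k ∈ Finset.range ⌈x⌉₊, h (k / x)) atTop
      (𝓝 (∫ s in (0 : ℝ)..1, h s)) := by
  have hii : ∀ a b, IntervalIntegrable h volume a b := fun a b =>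
    hh.continuous.intervalIntegrable a b
  have h1 : Tendsto (fun x : ℝ => ∫ s in (0 : ℝ)..(⌈x⌉₊ / x), h s) atTop
      (𝓝 (∫ s in (0 : ℝ)..1, h s)) :=
    ((intervalIntegral.continuous_primitive hii 0).tendsto 1).comp
      (tendsto_nat_ceil_div_atTop (R := ℝ))
  refine h1.congr_dist ?_
  rw [Metric.tendsto_atTop]
  intro ε hε
  obtain ⟨δ, hδ, hd⟩ := Metric.uniformContinuous_iff.1 hh (ε / 4) (by linarith)
  refine ⟨max 1 (2 / δ), fun x hx => ?_⟩
  have hx1 : 1 ≤ x := (le_max_left _ _).trans hx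
  have hx0 : 0 < x := by linarith
  have hxδ : 1 / x < δ := by
    have := (le_max_right _ _).trans hx
    rw [div_le_iff₀ hδ] at this
    rw [div_lt_iff₀ hx0]; linarith
  have hstep : ∀ k : ℕ, ((k + 1 : ℕ) : ℝ) / x - k / x = 1 / x := fun k => by push_cast; ring
  have hsum : ∫ s in (0 : ℝ)..(⌈x⌉₊ / x), h s =
      ∑ k ∈ Finset.range ⌈x⌉₊, ∫ s in ((k : ℝ) / x)..((k + 1 : ℕ) : ℝ) / x, h s := by
    rw [intervalIntegral.sum_integral_adjacent_intervals (a := fun k : ℕ => (k : ℝ) / x)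
      fun k _ => hii _ _]
    simp
  have hterm : ∀ k : ℕ,
      |(∫ s in ((k : ℝ) / x)..((k + 1 : ℕ) : ℝ) / x, h s) - 1 / x * h (k / x)| ≤
        ε / 4 * (1 / x) := by
    intro k
    have hc : ∫ _ in ((k : ℝ) / x)..((k + 1 : ℕ) : ℝ) / x, h (k / x) = 1 / x * h (k / x) := by
      rw [intervalIntegral.integral_const, hstep, smul_eq_mul]
    have hle : (k : ℝ) / x ≤ ((k + 1 : ℕ) : ℝ) / x := by
      have := hstep k
      have : 0 < 1 / x := by positivity
      linarith
    rw [← hc, ← intervalIntegral.integral_sub (hii _ _) (by simp), ← Real.norm_eq_abs]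
    refine (intervalIntegral.norm_integral_le_of_norm_le_const (C := ε / 4) fun s hs => ?_).trans
      (le_of_eq ?_)
    · rw [Set.uIoc_of_le hle] at hs
      refine le_of_lt ?_
      rw [← dist_eq_norm]
      refine hd ?_
      rw [Real.dist_eq, abs_of_nonneg (by linarith [hs.1])]
      linarith [hs.2, hstep k]
    · rw [hstep, abs_of_pos (by positivity)]
  have hn : (⌈x⌉₊ : ℝ) ≤ 2 * x := by linarith [Nat.ceil_lt_add_one hx0.le]
  rw [Real.dist_0_eq_abs, abs_of_nonneg dist_nonneg, Real.dist_eq, hsum, Finset.mul_sum,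
    ← Finset.sum_sub_distrib]
  calc _ ≤ ∑ k ∈ Finset.range ⌈x⌉₊, ε / 4 * (1 / x) :=
        (Finset.abs_sum_le_sum_abs _ _).trans (Finset.sum_le_sum fun k _ => hterm k)
    _ = ⌈x⌉₊ * (ε / 4 * (1 / x)) := by simp
    _ ≤ 2 * x * (ε / 4 * (1 / x)) := by gcongr
    _ = ε / 2 := by field_simp; norm_num
    _ < ε := by linarith

lemma tendsto_riemannSum {h : ℝ → ℝ} (hh : ContinuousOn h (Set.Icc 0 1)) :
    Tendsto (fun x : ℝ => 1 / x * ∑ k ∈ Finset.range ⌈x⌉₊, h (k / x)) atTop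
      (𝓝 (∫ s in (0 : ℝ)..1, h s)) := by
  -- Constant extension past `[0, 1]` serves the protruding last cell; the sample points `k / x`
  -- never see it.
  set H := Set.IccExtend (zero_le_one (α := ℝ)) (Set.domRestrict (Set.Icc (0 : ℝ) 1) h) with hH
  have hHh : ∀ s ∈ Set.Icc (0 : ℝ) 1, H s = h s := fun s hs => by
    rw [hH, Set.IccExtend_of_mem _ _ hs, Set.domRestrict_apply]
  have huc : UniformContinuous H :=
    (CompactSpace.uniformContinuous_of_continuous hh.domRestrict).comp
      (LipschitzWith.projIcc zero_le_one).uniformContinuous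
  have hint : ∫ s in (0 : ℝ)..1, H s = ∫ s in (0 : ℝ)..1, h s :=
    intervalIntegral.integral_congr fun s hs => hHh s (by simpa using hs)
  rw [← hint]
  refine (tendsto_riemannSum_of_uniformContinuous huc).congr' ?_
  filter_upwards [eventually_gt_atTop 0] with x hx
  congr 1
  refine Finset.sum_congr rfl fun k hk => hHh _ ⟨by positivity, ?_⟩
  rw [div_le_one hx]
  exact (Nat.lt_ceil.1 (Finset.mem_range.1 hk)).le

/-! ### The exponential rate -/

lemma one_div_mul_log_le {x a : ℝ} (hx : 0 < x) {p : ℝ≥0∞}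
    (hp : p ≤ ENNReal.ofReal (Real.exp (a * x))) :
    ((1 / x : ℝ) : EReal) * ENNReal.log p ≤ a := by
  have h1 : ENNReal.log p ≤ ((a * x : ℝ) : EReal) := by
    refine (ENNReal.log_monotone hp).trans (le_of_eq ?_)
    rw [ENNReal.log_ofReal_of_pos (Real.exp_pos _), Real.log_exp]
  calc ((1 / x : ℝ) : EReal) * ENNReal.log p ≤ ((1 / x : ℝ) : EReal) * ((a * x : ℝ) : EReal) :=
        mul_le_mul_of_nonneg_left h1 (by exact_mod_cast (by positivity : 0 ≤ 1 / x))
    _ = a := by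
        rw [← EReal.coe_mul]; congr 1; field_simp

lemma le_one_div_mul_log {x a : ℝ} (hx : 0 < x) {p : ℝ≥0∞}
    (hp : ENNReal.ofReal (Real.exp (a * x)) ≤ p) :
    (a : EReal) ≤ ((1 / x : ℝ) : EReal) * ENNReal.log p := by
  have h1 : ((a * x : ℝ) : EReal) ≤ ENNReal.log p := by
    refine (le_of_eq ?_).trans (ENNReal.log_monotone hp)
    rw [ENNReal.log_ofReal_of_pos (Real.exp_pos _), Real.log_exp]
  calc (a : EReal) = ((1 / x : ℝ) : EReal) * ((a * x : ℝ) : EReal) := by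
        rw [← EReal.coe_mul]; congr 1; field_simp
    _ ≤ _ := mul_le_mul_of_nonneg_left h1 (by exact_mod_cast (by positivity : 0 ≤ 1 / x))

/-! ### The integral over the unit interval -/

lemma unitIntegral_mono {f g : ℝ → EReal} (h : ∀ y, f y ≤ g y) :
    unitIntegral f ≤ unitIntegral g := by
  refine EReal.sub_le_sub ?_ ?_ <;> refine EReal.coe_ennreal_le_coe_ennreal_iff.2 ?_ <;>
    refine lintegral_mono fun y => EReal.toENNReal_le_toENNReal ?_
  · exact h y
  · exact EReal.neg_le_neg_iff.2 (h y)

lemma unitIntegral_coe {f : ℝ → EReal} {g : ℝ → ℝ} (hg : ContinuousOn g (Set.Icc 0 1))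
    (hfg : ∀ y ∈ Set.Icc (0 : ℝ) 1, f y = g y) :
    unitIntegral f = ((∫ y in (0 : ℝ)..1, g y : ℝ) : EReal) := by
  have hint : IntegrableOn g (Set.Icc 0 1) := hg.integrableOn_compact isCompact_Icc
  have h1 : ∫⁻ y in Set.Icc (0 : ℝ) 1, (f y).toENNReal =
      ∫⁻ y in Set.Icc (0 : ℝ) 1, ENNReal.ofReal (g y) :=
    setLIntegral_congr_fun measurableSet_Icc fun y hy => by
      simp only [hfg y hy, EReal.toENNReal_of_ne_top (EReal.coe_ne_top _), EReal.toReal_coe]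
  have h2 : ∫⁻ y in Set.Icc (0 : ℝ) 1, (-f y).toENNReal =
      ∫⁻ y in Set.Icc (0 : ℝ) 1, ENNReal.ofReal (-g y) :=
    setLIntegral_congr_fun measurableSet_Icc fun y hy => by
      simp only [hfg y hy, ← EReal.coe_neg, EReal.toENNReal_of_ne_top (EReal.coe_ne_top _),
        EReal.toReal_coe]
  have t1 : ∫⁻ y in Set.Icc (0 : ℝ) 1, ENNReal.ofReal (g y) ≠ ⊤ := hint.lintegral_lt_top.ne
  have t2 : ∫⁻ y in Set.Icc (0 : ℝ) 1, ENNReal.ofReal (-g y) ≠ ⊤ := hint.neg.lintegral_lt_top.ne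
  rw [intervalIntegral.integral_of_le zero_le_one, ← integral_Icc_eq_integral_Ioc,
    integral_eq_lintegral_pos_part_sub_lintegral_neg_part hint, unitIntegral, h1, h2,
    EReal.coe_sub, EReal.coe_ennreal_toReal t1, EReal.coe_ennreal_toReal t2]

/-! ### The logarithmic moment generating function of a positive random variable -/

section LogMgf

variable {Ω : Type*} [MeasurableSpace Ω] {P : Measure Ω} {Y : Ω → ℝ}

lemma logMgf_mono (hY : ∀ᵐ ω ∂P, 0 < Y ω) : Monotone (logMgf P Y) := fun a b hab =>
  ENNReal.log_monotone <| lintegral_mono_ae <| hY.mono fun ω hω => by gcongr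

lemma mem_effDomain_logMgf (hYm : Measurable Y) {a : ℝ} :
    a ∈ effDomain (logMgf P Y) ↔ a ∈ integrableExpSet Y P := by
  have hm : Measurable fun ω => Real.exp (a * Y ω) := by fun_prop
  have h := lintegral_ofReal_ne_top_iff_integrable (μ := P) hm.aestronglyMeasurable
    (ae_of_all _ fun ω => (Real.exp_pos _).le)
  rw [effDomain, Set.mem_ofPred_eq, logMgf, ENNReal.log_lt_top_iff, lt_top_iff_ne_top, h]
  rfl

lemma lintegral_exp_eq [NeZero P] {a : ℝ} (ha : a ∈ integrableExpSet Y P) :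
    ∫⁻ ω, ENNReal.ofReal (Real.exp (a * Y ω)) ∂P = ENNReal.ofReal (Real.exp (cgf Y P a)) := by
  have ha' : Integrable (fun ω => Real.exp (a * Y ω)) P := ha
  rw [exp_cgf ha', mgf, ofReal_integral_eq_lintegral_ofReal ha'
    (ae_of_all _ fun ω => (Real.exp_pos _).le)]

lemma logMgf_eq_cgf [NeZero P] {a : ℝ} (ha : a ∈ integrableExpSet Y P) :
    logMgf P Y a = (cgf Y P a : EReal) := by
  rw [logMgf, lintegral_exp_eq ha, ENNReal.log_ofReal_of_pos (Real.exp_pos _), Real.log_exp]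

/-- The pairs `α` such that `φ` is finite near the segment from `α₁` to `α₁ + α₂`. -/
def innerDomain (P : Measure Ω) (Y : Ω → ℝ) : Set (ℝ × ℝ) :=
  {α | α.1 ∈ interior (integrableExpSet Y P) ∧ α.1 + α.2 ∈ interior (integrableExpSet Y P)}

/-- The real-valued version of `Λ` on `innerDomain`. -/
def innerLam (P : Measure Ω) (Y : Ω → ℝ) (α : ℝ × ℝ) : ℝ :=
  ∫ y in (0 : ℝ)..1, cgf Y P (α.1 + α.2 * y)

lemma isOpen_innerDomain : IsOpen (innerDomain P Y) :=
  (isOpen_interior.preimage continuous_fst).inter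
    (isOpen_interior.preimage (continuous_fst.add continuous_snd))

lemma segment_mem_interior {α : ℝ × ℝ} (hα : α ∈ innerDomain P Y) {y : ℝ}
    (hy : y ∈ Set.Icc (0 : ℝ) 1) : α.1 + α.2 * y ∈ interior (integrableExpSet Y P) := by
  have h := (convex_integrableExpSet (X := Y) (μ := P)).interior hα.1 hα.2
    (sub_nonneg.2 hy.2) hy.1 (by ring)
  convert h using 1
  simp only [smul_eq_mul]
  ring

lemma continuousOn_cgf_segment {α : ℝ × ℝ} (hα : α ∈ innerDomain P Y) :
    ContinuousOn (fun y => cgf Y P (α.1 + α.2 * y)) (Set.Icc 0 1) :=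
  analyticOnNhd_cgf.continuousOn.comp (by fun_prop) fun _ hy => segment_mem_interior hα hy

lemma Iio_subset_interior (hYm : Measurable Y) (hY : ∀ᵐ ω ∂P, 0 < Y ω) {a : ℝ}
    (ha : a ∈ integrableExpSet Y P) : Set.Iio a ⊆ interior (integrableExpSet Y P) := by
  refine interior_maximal (fun b hb => ?_) isOpen_Iio
  rw [← mem_effDomain_logMgf hYm] at ha ⊢
  exact lt_of_le_of_lt (logMgf_mono hY (le_of_lt hb)) ha

lemma innerDomain_subset_domainD (hYm : Measurable Y) :
    innerDomain P Y ⊆ domainD (logMgf P Y) := by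
  intro α hα
  rcases le_or_gt 0 α.2 with h | h
  · exact Or.inl ⟨h, (mem_effDomain_logMgf hYm).2 (interior_subset hα.2)⟩
  · exact Or.inr ⟨h, le_iSup₂_of_le α.1 ((mem_effDomain_logMgf hYm).2 (interior_subset hα.1))
      le_rfl⟩

lemma Lam_eq_innerLam [NeZero P] (hYm : Measurable Y) {α : ℝ × ℝ} (hα : α ∈ innerDomain P Y) :
    Lam (logMgf P Y) α = (innerLam P Y α : EReal) := by
  rw [Lam, if_pos (innerDomain_subset_domainD hYm hα)]
  exact unitIntegral_coe (continuousOn_cgf_segment hα) fun y hy =>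
    logMgf_eq_cgf (interior_subset (segment_mem_interior hα hy))

/-- The effective domain of `φ` is a left half-line or the whole line, so only the larger endpoint
of the segment matters, and a left shift makes both endpoints interior. -/
lemma shift_mem_innerDomain (hYm : Measurable Y) (hY : ∀ᵐ ω ∂P, 0 < Y ω) {β : ℝ × ℝ}
    (hβ : β ∈ domainD (logMgf P Y)) {ε : ℝ} (hε : 0 < ε) :
    (β.1 - ε, β.2) ∈ innerDomain P Y := by
  rcases hβ with ⟨h, h'⟩ | ⟨h, h'⟩
  · have hs := Iio_subset_interior hYm hY ((mem_effDomain_logMgf hYm).1 h')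
    exact ⟨hs (by simp only [Set.mem_Iio]; linarith), hs (by simp only [Set.mem_Iio]; linarith)⟩
  · have hlt : ((β.1 - ε : ℝ) : EReal) < rightEnd (logMgf P Y) :=
      lt_of_lt_of_le (by exact_mod_cast sub_lt_self _ hε) h'
    simp only [rightEnd, lt_iSup_iff] at hlt
    obtain ⟨a, ha, hlt⟩ := hlt
    have hlt' : β.1 - ε < a := by exact_mod_cast hlt
    have hs := Iio_subset_interior hYm hY ((mem_effDomain_logMgf hYm).1 ha)
    exact ⟨hs hlt', hs (by simp only [Set.mem_Iio]; linarith)⟩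

lemma innerLam_shift_le_Lam [NeZero P] (hYm : Measurable Y) (hY : ∀ᵐ ω ∂P, 0 < Y ω) {β : ℝ × ℝ}
    (hβ : β ∈ domainD (logMgf P Y)) {ε : ℝ} (hε : 0 < ε) :
    (innerLam P Y (β.1 - ε, β.2) : EReal) ≤ Lam (logMgf P Y) β := by
  have hs := shift_mem_innerDomain hYm hY hβ hε
  rw [← Lam_eq_innerLam hYm hs, Lam, Lam, if_pos hβ, if_pos (innerDomain_subset_domainD hYm hs)]
  exact unitIntegral_mono fun y => logMgf_mono hY (by simp only; linarith)

lemma zero_mem_innerDomain (hYm : Measurable Y)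
    (h0 : (0 : ℝ) ∈ interior (effDomain (logMgf P Y))) : (0 : ℝ × ℝ) ∈ innerDomain P Y := by
  have : effDomain (logMgf P Y) = integrableExpSet Y P := Set.ext fun _ => mem_effDomain_logMgf hYm
  rw [this] at h0
  exact ⟨h0, by simpa using h0⟩

/-! ### The Legendre transform of `Λ` -/

lemma mem_domainD_of_lt {β z : ℝ × ℝ} {c : EReal}
    (h : c < ((β.1 * z.1 + β.2 * z.2 : ℝ) : EReal) - Lam (logMgf P Y) β) :
    β ∈ domainD (logMgf P Y) := by
  by_contra hβ
  rw [Lam, if_neg hβ, EReal.sub_top] at h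
  exact not_lt_bot h

lemma exists_lt_of_lt_legendre [NeZero P] (hYm : Measurable Y) (hY : ∀ᵐ ω ∂P, 0 < Y ω) {c : ℝ}
    {z : ℝ × ℝ} (h : (c : EReal) < legendre (Lam (logMgf P Y)) z) :
    ∃ α ∈ innerDomain P Y, c + innerLam P Y α < α.1 * z.1 + α.2 * z.2 := by
  obtain ⟨β, hlt⟩ := lt_iSup_iff.1 h
  have hβ := mem_domainD_of_lt hlt
  have hbot : Lam (logMgf P Y) β ≠ ⊥ :=
    ne_bot_of_le_ne_bot (EReal.coe_ne_bot _) (innerLam_shift_le_Lam hYm hY hβ one_pos)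
  have htop : Lam (logMgf P Y) β ≠ ⊤ := fun htop => by
    rw [htop, EReal.sub_top] at hlt
    exact not_lt_bot hlt
  obtain ⟨l, hl⟩ : ∃ l : ℝ, Lam (logMgf P Y) β = l := ⟨_, (EReal.coe_toReal htop hbot).symm⟩
  rw [hl, ← EReal.coe_sub, EReal.coe_lt_coe_iff] at hlt
  -- The shift costs at most `ε * |z.1|`, less than the gap; the `+ 1` gives strictness and covers
  -- `z.1 = 0`.
  set ε := (β.1 * z.1 + β.2 * z.2 - l - c) / (|z.1| + 1) with hε
  have hpos : 0 < |z.1| + 1 := by positivity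
  have hε0 : 0 < ε := div_pos (by linarith) hpos
  have hle := innerLam_shift_le_Lam hYm hY hβ hε0
  rw [hl, EReal.coe_le_coe_iff] at hle
  refine ⟨_, shift_mem_innerDomain hYm hY hβ hε0, ?_⟩
  have h1 : ε * (|z.1| + 1) = β.1 * z.1 + β.2 * z.2 - l - c := div_mul_cancel₀ _ hpos.ne'
  have h2 : ε * z.1 ≤ ε * |z.1| := mul_le_mul_of_nonneg_left (le_abs_self _) hε0.le
  simp only
  linarith

lemma le_legendre [NeZero P] (hYm : Measurable Y) {α : ℝ × ℝ} (hα : α ∈ innerDomain P Y)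
    (z : ℝ × ℝ) :
    ((α.1 * z.1 + α.2 * z.2 - innerLam P Y α : ℝ) : EReal) ≤ legendre (Lam (logMgf P Y)) z := by
  refine le_iSup_of_le α (le_of_eq ?_)
  rw [Lam_eq_innerLam hYm hα, EReal.coe_sub]

/-- Moving `z` in the direction `v` raises `Λ*` by at most `s` if `⟨β, v⟩ ≤ s` on `𝒟`. -/
lemma legendre_add_le {z v : ℝ × ℝ} {s : ℝ}
    (hs : ∀ β ∈ domainD (logMgf P Y), β.1 * v.1 + β.2 * v.2 ≤ s) :
    legendre (Lam (logMgf P Y)) (z + v) ≤ legendre (Lam (logMgf P Y)) z + s := by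
  refine iSup_le fun β => ?_
  by_cases hβ : β ∈ domainD (logMgf P Y)
  · calc ((β.1 * (z + v).1 + β.2 * (z + v).2 : ℝ) : EReal) - Lam (logMgf P Y) β
        ≤ ((β.1 * z.1 + β.2 * z.2 + s : ℝ) : EReal) - Lam (logMgf P Y) β := by
          refine EReal.sub_le_sub (EReal.coe_le_coe_iff.2 ?_) le_rfl
          have := hs β hβ
          simp only [Prod.fst_add, Prod.snd_add]
          linarith
      _ = (((β.1 * z.1 + β.2 * z.2 : ℝ) : EReal) - Lam (logMgf P Y) β) + s := by
          rw [EReal.coe_add, sub_eq_add_neg, sub_eq_add_neg, add_right_comm]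
      _ ≤ _ := by
          gcongr
          exact le_iSup (fun α : ℝ × ℝ => ((α.1 * z.1 + α.2 * z.2 : ℝ) : EReal) -
            Lam (logMgf P Y) α) β
  · rw [Lam, if_neg hβ, EReal.sub_top]
    exact bot_le

/-- A hyperplane that exposes a point of `Λ*` lies in `innerDomain`. -/
lemma mem_innerDomain_of_exposes [NeZero P] (hYm : Measurable Y) (hY : ∀ᵐ ω ∂P, 0 < Y ω)
    (h0 : (0 : ℝ × ℝ) ∈ innerDomain P Y) {η z : ℝ × ℝ} (hη : ∀ w : ℝ × ℝ, w ≠ z →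
      ((η.1 * w.1 + η.2 * w.2 : ℝ) : EReal) - legendre (Lam (logMgf P Y)) w <
        ((η.1 * z.1 + η.2 * z.2 : ℝ) : EReal) - legendre (Lam (logMgf P Y)) z) :
    η ∈ innerDomain P Y := by
  have hbot : ∀ w, legendre (Lam (logMgf P Y)) w ≠ ⊥ := fun w =>
    ne_bot_of_le_ne_bot (EReal.coe_ne_bot _) (le_legendre hYm h0 w)
  have key : ∀ v : ℝ × ℝ, v ≠ 0 →
      ∃ β ∈ domainD (logMgf P Y), η.1 * v.1 + η.2 * v.2 < β.1 * v.1 + β.2 * v.2 := by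
    intro v hv
    by_contra! hcon
    have h1 := hη (z + v) (by simpa using hv)
    have h2 := legendre_add_le (z := z) hcon
    have htop : legendre (Lam (logMgf P Y)) z ≠ ⊤ := fun htop => by
      rw [htop, EReal.sub_top] at h1
      exact not_lt_bot h1
    obtain ⟨l, hl⟩ : ∃ l : ℝ, legendre (Lam (logMgf P Y)) z = l :=
      ⟨_, (EReal.coe_toReal htop (hbot z)).symm⟩
    rw [hl, ← EReal.coe_add] at h2
    obtain ⟨l', hl'⟩ : ∃ l' : ℝ, legendre (Lam (logMgf P Y)) (z + v) = l' :=
      ⟨_, (EReal.coe_toReal (ne_top_of_le_ne_top (EReal.coe_ne_top _) h2) (hbot _)).symm⟩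
    rw [hl', EReal.coe_le_coe_iff] at h2
    rw [hl, hl', ← EReal.coe_sub, ← EReal.coe_sub, EReal.coe_lt_coe_iff] at h1
    simp only [Prod.fst_add, Prod.snd_add] at h1
    linarith
  constructor
  -- The directions `(1, 0)` and `(1, 1)` test the two ends `η.1` and `η.1 + η.2` of the segment. In
  -- each case the shift is chosen so that the corresponding end of the shifted `β` is that of `η`.
  · obtain ⟨β, hβ, hlt⟩ := key (1, 0) (by simp)
    simp only [mul_one, mul_zero, add_zero] at hlt
    simpa using (shift_mem_innerDomain hYm hY hβ (sub_pos.2 hlt)).1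
  · obtain ⟨β, hβ, hlt⟩ := key (1, 1) (by simp)
    simp only [mul_one] at hlt
    have h := (shift_mem_innerDomain hYm hY hβ (sub_pos.2 hlt)).2
    convert h using 1
    ring

end LogMgf

/-! ### The law of the weighted pair -/

section Law

variable {Ω : Type*} [MeasurableSpace Ω] {P : Measure Ω} [IsProbabilityMeasure P]
  {T : ℕ → Ω → ℝ}

lemma measurable_weightedPair (hmeas : ∀ n, Measurable (T n)) (x : ℝ) :
    Measurable fun ω => weightedPair (fun n => T n ω) x := by
  unfold weightedPair
  fun_prop

/-- The law of `weightedPair`. -/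
def pairLaw (P : Measure Ω) (T : ℕ → Ω → ℝ) (x : ℝ) : Measure (ℝ × ℝ) :=
  P.map fun ω => weightedPair (fun n => T n ω) x

omit [IsProbabilityMeasure P] in
-- The path formula holds almost surely, which suffices to replace the event by a measurable one
-- without studying measurability of `tau` and `area`.
lemma logProbRate_eq (hmeas : ∀ n, Measurable (T n)) (hpos : ∀ n, ∀ᵐ ω ∂P, 0 < T n ω)
    {B : Set (ℝ × ℝ)} (hB : MeasurableSet B) {x : ℝ} (hx : 0 < x) :
    logProbRate P T B x = ((1 / x : ℝ) : EReal) * ENNReal.log (pairLaw P T x B) := by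
  rw [logProbRate, pairLaw, Measure.map_apply (measurable_weightedPair hmeas x) hB]
  congr 2
  refine measure_congr ?_
  filter_upwards [ae_all_iff.2 hpos] with ω hω
  exact congrArg (· ∈ B) (scaledPair_eq_weightedPair hω hx)

lemma lintegral_exp_weightedSum (hmeas : ∀ n, Measurable (T n)) (hindep : iIndepFun T P)
    (hident : ∀ n, IdentDistrib (T n) (T 0) P P) (s : Finset ℕ) (a : ℕ → ℝ)
    (ha : ∀ k ∈ s, a k ∈ integrableExpSet (T 0) P) :
    ∫⁻ ω, ENNReal.ofReal (Real.exp (∑ k ∈ s, a k * T k ω)) ∂P =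
      ENNReal.ofReal (Real.exp (∑ k ∈ s, cgf (T 0) P (a k))) := by
  set X : ℕ → Ω → ℝ := fun k ω => a k * T k ω with hX
  have hXm : ∀ k, Measurable (X k) := fun k => (hmeas k).const_mul _
  have hXi : iIndepFun X P := hindep.comp (fun k t => a k * t) fun k => by fun_prop
  have hdist : ∀ k, IdentDistrib (fun ω => Real.exp (a k * T k ω))
      (fun ω => Real.exp (a k * T 0 ω)) P P := fun k =>
    (hident k).comp (u := fun t => Real.exp (a k * t)) (by fun_prop)
  have hint : ∀ k ∈ s, Integrable (fun ω => Real.exp (1 * X k ω)) P := fun k hk => by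
    simpa only [one_mul] using (hdist k).integrable_iff.2 (ha k hk)
  have hcgf : ∀ k, cgf (X k) P 1 = cgf (T 0) P (a k) := fun k => by
    simp only [cgf, mgf, one_mul, hX]
    rw [(hdist k).integral_eq]
  have h := lintegral_exp_eq (hXi.integrable_exp_mul_sum hXm hint)
  rw [hXi.cgf_sum hXm hint] at h
  simpa only [one_mul, hcgf, Finset.sum_apply] using h

lemma scaledMgf_pairLaw (hmeas : ∀ n, Measurable (T n)) (hindep : iIndepFun T P)
    (hident : ∀ n, IdentDistrib (T n) (T 0) P P) {α : ℝ × ℝ} (hα : α ∈ innerDomain P (T 0))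
    {x : ℝ} (hx : 0 < x) :
    scaledMgf (pairLaw P T x) x α = ENNReal.ofReal (Real.exp
      (∑ k ∈ Finset.range ⌈x⌉₊, cgf (T 0) P (α.1 + α.2 * (1 - k / x)))) := by
  rw [scaledMgf, pairLaw, lintegral_map (by fun_prop) (measurable_weightedPair hmeas x)]
  simp only [mul_pairing_weightedPair _ hx.ne']
  refine lintegral_exp_weightedSum hmeas hindep hident _ (fun k : ℕ => α.1 + α.2 * (1 - k / x))
    -- For `k < ⌈x⌉` one has `k < x`, so the weight `1 - k / x` lies in `[0, 1]`.
    fun k hk => interior_subset (segment_mem_interior hα ⟨?_, ?_⟩)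
  · rw [sub_nonneg, div_le_one hx]
    exact (Nat.lt_ceil.1 (Finset.mem_range.1 hk)).le
  · rw [sub_le_self_iff]
    positivity

omit [IsProbabilityMeasure P] in
lemma tendsto_cgf_sum {α : ℝ × ℝ} (hα : α ∈ innerDomain P (T 0)) :
    Tendsto (fun x : ℝ =>
        1 / x * ∑ k ∈ Finset.range ⌈x⌉₊, cgf (T 0) P (α.1 + α.2 * (1 - k / x))) atTop
      (𝓝 (innerLam P (T 0) α)) := by
  have hc : ContinuousOn (fun s : ℝ => cgf (T 0) P (α.1 + α.2 * (1 - s))) (Set.Icc 0 1) :=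
    (continuousOn_cgf_segment hα).comp (t := Set.Icc 0 1) (f := fun s : ℝ => 1 - s)
      (by fun_prop) fun s hs => ⟨by linarith [hs.2], by linarith [hs.1]⟩
  have h := tendsto_riemannSum hc
  rw [intervalIntegral.integral_comp_sub_left (fun y => cgf (T 0) P (α.1 + α.2 * y)) 1] at h
  simpa only [sub_self, sub_zero, innerLam] using h

lemma eventually_scaledMgf_le (hmeas : ∀ n, Measurable (T n)) (hindep : iIndepFun T P)
    (hident : ∀ n, IdentDistrib (T n) (T 0) P P) {α : ℝ × ℝ} (hα : α ∈ innerDomain P (T 0))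
    {ε : ℝ} (hε : 0 < ε) :
    ∀ᶠ x in atTop, scaledMgf (pairLaw P T x) x α ≤
      ENNReal.ofReal (Real.exp (x * (innerLam P (T 0) α + ε))) := by
  filter_upwards [(tendsto_cgf_sum hα).eventually_lt_const (lt_add_of_pos_right _ hε),
    eventually_gt_atTop 0] with x h hx
  rw [scaledMgf_pairLaw hmeas hindep hident hα hx]
  rw [one_div, inv_mul_lt_iff₀ hx] at h
  gcongr

lemma eventually_le_scaledMgf (hmeas : ∀ n, Measurable (T n)) (hindep : iIndepFun T P)
    (hident : ∀ n, IdentDistrib (T n) (T 0) P P) {α : ℝ × ℝ} (hα : α ∈ innerDomain P (T 0))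
    {ε : ℝ} (hε : 0 < ε) :
    ∀ᶠ x in atTop, ENNReal.ofReal (Real.exp (x * (innerLam P (T 0) α - ε))) ≤
      scaledMgf (pairLaw P T x) x α := by
  filter_upwards [(tendsto_cgf_sum hα).eventually_const_lt (sub_lt_self _ hε),
    eventually_gt_atTop 0] with x h hx
  rw [scaledMgf_pairLaw hmeas hindep hident hα hx]
  rw [one_div, lt_inv_mul_iff₀ hx] at h
  gcongr

end Law

end FirstPassage

end

/-! ### The large deviation bounds -/

theorem proposition1 {Ω : Type*} [MeasurableSpace Ω] (P : Measure Ω) [IsProbabilityMeasure P]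
    (T : ℕ → Ω → ℝ)
    (hmeas : ∀ n, Measurable (T n))
    (hindep : iIndepFun T P)
    (hident : ∀ n, IdentDistrib (T n) (T 0) P P)
    (hpos : ∀ n, ∀ᵐ ω ∂P, 0 < T n ω)
    (hlight : (0 : ℝ) ∈ interior (FirstPassage.effDomain (FirstPassage.logMgf P (T 0)))) :
    (∀ᶠ α in 𝓝 ((0, 0) : ℝ × ℝ),
      ⊥ < FirstPassage.Lam (FirstPassage.logMgf P (T 0)) α ∧
        FirstPassage.Lam (FirstPassage.logMgf P (T 0)) α < ⊤) ∧
    (∀ C : Set (ℝ × ℝ), IsClosed C →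
      limsup (fun x : ℝ => FirstPassage.logProbRate P T C x) atTop ≤
        -⨅ z ∈ C,
          FirstPassage.legendre (FirstPassage.Lam (FirstPassage.logMgf P (T 0))) z) ∧
    (∀ O : Set (ℝ × ℝ), IsOpen O →
      -(⨅ z ∈ O ∩ FirstPassage.exposedPts
            (FirstPassage.legendre (FirstPassage.Lam (FirstPassage.logMgf P (T 0)))),
          FirstPassage.legendre (FirstPassage.Lam (FirstPassage.logMgf P (T 0))) z) ≤
        liminf (fun x : ℝ => FirstPassage.logProbRate P T O x) atTop) := by
  have hYm := hmeas 0
  have hY := hpos 0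
  have h0 := FirstPassage.zero_mem_innerDomain hYm hlight
  have hL := fun α (hα : α ∈ FirstPassage.innerDomain P (T 0)) ε (hε : (0 : ℝ) < ε) =>
    FirstPassage.eventually_scaledMgf_le hmeas hindep hident hα hε
  refine ⟨?_, fun C hC => ?_, fun O hO => ?_⟩
  · filter_upwards [FirstPassage.isOpen_innerDomain.mem_nhds h0] with α hα
    rw [FirstPassage.Lam_eq_innerLam hYm hα]
    exact ⟨EReal.bot_lt_coe _, EReal.coe_lt_top _⟩
  · refine EReal.le_of_forall_lt_iff_le.1 fun b hb => ?_
    rw [EReal.neg_lt_comm, ← EReal.coe_neg] at hb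
    obtain ⟨c, hc, hdec⟩ := FirstPassage.decaysFaster_of_isClosed
      ((FirstPassage.isOpen_innerDomain (P := P) (Y := T 0)).interior_eq.symm ▸ h0) hL hC fun w hw =>
        FirstPassage.exists_lt_of_lt_legendre hYm hY (hb.trans_le (iInf₂_le w hw))
    refine limsup_le_of_le (h := ?_)
    filter_upwards [hdec, eventually_gt_atTop 0] with x hx hx0
    rw [FirstPassage.logProbRate_eq hmeas hpos hC.measurableSet hx0]
    exact (FirstPassage.one_div_mul_log_le hx0 hx).trans (by exact_mod_cast (by linarith : -c ≤ b))
  · rw [EReal.neg_le]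
    refine le_iInf₂ fun z hz => ?_
    obtain ⟨hzO, η, hη⟩ := hz
    have hηG := FirstPassage.mem_innerDomain_of_exposes hYm hY h0 hη
    have hsub : ∀ w : ℝ × ℝ, ((η.1 * w.1 + η.2 * w.2 : ℝ) : EReal) -
        ((η.1 * w.1 + η.2 * w.2 - FirstPassage.innerLam P (T 0) η : ℝ) : EReal) =
          FirstPassage.innerLam P (T 0) η := fun w => by
      rw [← EReal.coe_sub, sub_sub_cancel]
    have hz' : ∀ w, w ≠ z → ∃ α ∈ FirstPassage.innerDomain P (T 0),
        η.1 * w.1 + η.2 * w.2 - FirstPassage.innerLam P (T 0) η <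
          α.1 * w.1 + α.2 * w.2 - FirstPassage.innerLam P (T 0) α := by
      intro w hw
      -- Since `Λ*(z) ≥ ⟨η, z⟩ - Λ(η)`, exposure gives `Λ*(w) > ⟨η, w⟩ - Λ(η)`, so some `α` in
      -- `innerDomain` beats `η` at `w`. No duality `Λ** = Λ` is used.
      have hlt := (hη w hw).trans_le
        (EReal.sub_le_sub le_rfl (FirstPassage.le_legendre hYm hηG z))
      rw [hsub] at hlt
      have hleg : ((η.1 * w.1 + η.2 * w.2 - FirstPassage.innerLam P (T 0) η : ℝ) : EReal) <
          FirstPassage.legendre (FirstPassage.Lam (FirstPassage.logMgf P (T 0))) w := by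
        by_contra! hle
        have := hlt.trans_le ((hsub w).symm.le.trans (EReal.sub_le_sub le_rfl hle))
        exact lt_irrefl _ this
      obtain ⟨α, hα, h⟩ := FirstPassage.exists_lt_of_lt_legendre hYm hY hleg
      exact ⟨α, hα, by linarith⟩
    rw [EReal.neg_le]
    -- The same inequality shows that the rate `Λ(η) - ⟨η, z⟩` obtained by tilting is at least
    -- `-Λ*(z)`.
    have hle := FirstPassage.le_legendre hYm hηG z
    rw [← EReal.neg_le_neg_iff, ← EReal.coe_neg, neg_sub] at hle
    refine hle.trans (EReal.ge_of_forall_gt_iff_ge.1 fun a ha => ?_)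
    have hlow := FirstPassage.eventually_exp_le_measure (FirstPassage.isOpen_innerDomain (P := P) (Y := T 0)) hL hηG
      (fun ε hε => FirstPassage.eventually_le_scaledMgf hmeas hindep hident hηG hε) hz' hO hzO
      (EReal.coe_lt_coe_iff.1 ha)
    refine le_liminf_of_le (h := ?_)
    filter_upwards [hlow, eventually_gt_atTop 0] with x hx hx0
    rw [FirstPassage.logProbRate_eq hmeas hpos hO.measurableSet hx0]
    exact FirstPassage.le_one_div_mul_log hx0 hx
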